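/- Let $k\in\mathbb N$ and let $\lambda_1,\dots,\lambda_k,\gamma_1,\dots,\gamma_k:[0,\infty)\to[0,\infty)$ be deterministic intensity functions with finite integrals on bounded intervals. For $0\le s\le t$ write $$\Lambda_j(s,t)=\int_s^t\lambda_j(u)\,du,\qquad T_j(s,t)=\int_s^t\gamma_j(u)\,du,\qquad \Lambda_j(t)=\Lambda_j(0,t),\qquad T_j(t)=T_j(0,t).$$ A non-homogeneous generalized counting process (NGCP) with intensities $\lambda_1,\dots,\lambda_k$ is a process $\{M(t)\}_{t\ge0}$ with values in $\{0,1,2,\dots\}$ such that $M(0)=0$, $M$ has independent increments, and for all $0\le s\le t$ and all integers $n\ge0$ $$P\{M(t)-M(s)=n\}=\sum_{\substack{x_1,\dots,x_k\ge 0\\ x_1+2x_2+\cdots+kx_k=n}}\ \prod_{j=1}^{k}\frac{\Lambda_j(s,t)^{x_j}}{x_j!}\;e^{-\sum_{j=1}^k\Lambda_j(s,t)}.$$ Let $\{M_1(t)\}_{t\ge0}$ and $\{M_2(t)\}_{t\ge0}$ be two independent NGCPs on a probability space, with intensities $\lambda_1,\dots,\lambda_k$ and $\gamma_1,\dots,\gamma_k$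 respectively, and let $S(t)=M_1(t)-M_2(t)$ be the corresponding non-homogeneous generalized Skellam process (NGSP). Then the process $$\Big\{S(t)-\sum_{j=1}^{k}j\,\big(\Lambda_j(t)-T_j(t)\big)\Big\}_{t\ge0}$$ is a martingale with respect to the natural filtration $\mathcal F_t=\sigma\big(S(s),\,0<s\le t\big)$, $t\ge0$. -/

import Mathlib

open MeasureTheory ProbabilityTheory
open scoped NNReal

noncomputable section

namespace Skellam

/-- A family of deterministic intensity functions `λ₁, …, λₖ : [0, ∞) → [0, ∞)` with finite
cumulative rates `∫₀ᵗ λⱼ(u) du < ∞` for every `t ≥ 0`. The intensity `λⱼ` of jumps of size `j` is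
stored at the index `j - 1 : Fin k`; only the values on `[0, ∞)` matter. -/
structure IsIntensity {k : ℕ} (lam : Fin k → ℝ → ℝ) : Prop where
  nonneg : ∀ j, ∀ u, 0 ≤ u → 0 ≤ lam j u
  integrable : ∀ j, ∀ t : ℝ≥0, IntervalIntegrable (lam j) volume 0 t

/-- The cumulative rate `∫ₛᵗ f(u) du`. -/
def cumRate (f : ℝ → ℝ) (s t : ℝ≥0) : ℝ := ∫ u in (s : ℝ)..(t : ℝ), f u

/-- The set of all `(x₁, …, xₖ)` of natural numbers with `∑ⱼ j xⱼ = n` (the bound `xⱼ ≤ n`, which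
makes this visibly a finite set, follows from the equation). -/
def jumpCounts (k n : ℕ) : Finset (Fin k → ℕ) :=
  (Fintype.piFinset fun _ : Fin k => Finset.range (n + 1)).filter
    fun x => ∑ j : Fin k, ((j : ℕ) + 1) * x j = n

/-- The probability that a non-homogeneous generalized counting process with intensities
`λ₁, …, λₖ` increases by `n` between the times `s ≤ t`:
`∑_{x₁ + 2 x₂ + ⋯ + k xₖ = n} ∏ⱼ Λⱼ(s,t)^{xⱼ} / xⱼ! · exp (-∑ⱼ Λⱼ(s,t))`. -/
def incrementProb {k : ℕ} (lam : Fin k → ℝ → ℝ) (s t : ℝ≥0) (n : ℕ) : ℝ :=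
  ∑ x ∈ jumpCounts k n,
    (∏ j, cumRate (lam j) s t ^ x j / (Nat.factorial (x j) : ℝ)) *
      Real.exp (-∑ j, cumRate (lam j) s t)

/-- `M` is a non-homogeneous generalized counting process (NGCP) with intensities `λ₁, …, λₖ`:
it starts at `0`, has independent increments, and its increments have the distribution
`incrementProb`. Regularity of the paths is not required. -/
structure IsNGCP {Ω : Type*} [MeasurableSpace Ω] (P : Measure Ω) {k : ℕ}
    (lam : Fin k → ℝ → ℝ) (M : ℝ≥0 → Ω → ℕ) : Prop where
  measurable : ∀ t, Measurable (M t)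
  zero : ∀ ω, M 0 ω = 0
  indepIncrements : HasIndepIncrements (fun t ω => (M t ω : ℤ)) P
  increment_law : ∀ s t : ℝ≥0, s ≤ t → ∀ n : ℕ,
    P.real {ω | (M t ω : ℤ) - (M s ω : ℤ) = (n : ℤ)} = incrementProb lam s t n

/-- `S` is a non-homogeneous generalized Skellam process (NGSP) with intensities `λⱼ`, `γⱼ`: the
difference of two independent NGCPs with intensities `λⱼ` and `γⱼ` respectively. -/
def IsNGSP {Ω : Type*} [MeasurableSpace Ω] (P : Measure Ω) {k : ℕ}
    (lam gam : Fin k → ℝ → ℝ) (S : ℝ≥0 → Ω → ℤ) : Prop :=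
  ∃ M₁ M₂ : ℝ≥0 → Ω → ℕ, IsNGCP P lam M₁ ∧ IsNGCP P gam M₂ ∧
    IndepFun (fun ω t => M₁ t ω) (fun ω t => M₂ t ω) P ∧
    ∀ t ω, S t ω = (M₁ t ω : ℤ) - (M₂ t ω : ℤ)

theorem IsNGSP.measurable {Ω : Type*} [MeasurableSpace Ω] {P : Measure Ω} {k : ℕ}
    {lam gam : Fin k → ℝ → ℝ} {S : ℝ≥0 → Ω → ℤ} (h : IsNGSP P lam gam S) (t : ℝ≥0) :
    Measurable (S t) := by
  obtain ⟨M₁, M₂, h₁, h₂, -, hS⟩ := h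
  have e : S t = fun ω => (M₁ t ω : ℤ) - (M₂ t ω : ℤ) := funext (hS t)
  rw [e]
  exact (measurable_from_top.comp (h₁.measurable t)).sub
    (measurable_from_top.comp (h₂.measurable t))

/-- The filtration `ℱₜ = σ(S(s), 0 < s ≤ t)` generated by the process `S`. -/
def naturalFiltration {Ω : Type*} [m : MeasurableSpace Ω] (S : ℝ≥0 → Ω → ℤ)
    (hS : ∀ t, Measurable (S t)) : Filtration ℝ≥0 m where
  seq t := ⨆ s ∈ Set.Ioc 0 t, MeasurableSpace.comap (S s) inferInstance
  mono' _ _ h := biSup_mono fun _ hs => ⟨hs.1, hs.2.trans h⟩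
  le' _ := iSup₂_le fun s _ => (hS s).comap_le

end Skellam

end

/-! Each increment of `M₁` after time `s` is independent of the past of `M₁` and of all of `M₂`, and
symmetrically for `M₂`. Since `ℱₛ` is contained in the σ-algebra of that past and the other process,
conditioning on `ℱₛ` replaces both increments by their means (`IsNGCP.condExp_increment`), and the
compensator cancels exactly these. The means come from the law at a single time: `M(t)` is
distributed as `∑ j Xⱼ` with `Xⱼ` independent Poisson of mean `Λⱼ(t)` (`IsNGCP.map_eq`), so it is
integrable with mean `∑ j Λⱼ(t)`. -/

namespace Skellam

/-! ### Independence of increments from the past -/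

section Independence

variable {Ω : Type*} {mΩ : MeasurableSpace Ω} {P : Measure Ω}

/-- If `f` and `g` are independent and the pair `(f, g)` is independent of `h`, then `f` is
independent of the pair `(g, h)`. -/
theorem indepFun_prodMk_right_of_indepFun_prodMk_left {α β γ : Type*} [MeasurableSpace α]
    [MeasurableSpace β] [MeasurableSpace γ] [IsFiniteMeasure P] {f : Ω → α} {g : Ω → β} {h : Ω → γ}
    (hf : Measurable f) (hg : Measurable g) (hh : Measurable h) (hfg : IndepFun f g P)
    (hfgh : IndepFun (fun ω => (f ω, g ω)) h P) : IndepFun f (fun ω => (g ω, h ω)) P := by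
  have hgh : IndepFun g h P := hfgh.comp measurable_snd measurable_id
  rw [indepFun_iff_map_prod_eq_prod_map_map hf.aemeasurable (hg.prodMk hh).aemeasurable,
    (indepFun_iff_map_prod_eq_prod_map_map hg.aemeasurable hh.aemeasurable).1 hgh,
    ← Measure.prodAssoc_prod,
    ← (indepFun_iff_map_prod_eq_prod_map_map hf.aemeasurable hg.aemeasurable).1 hfg,
    ← (indepFun_iff_map_prod_eq_prod_map_map (hf.prodMk hg).aemeasurable hh.aemeasurable).1 hfgh,
    Measure.map_map MeasurableEquiv.prodAssoc.measurable ((hf.prodMk hg).prodMk hh)]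
  rfl

/-- Along a monotone sequence of times at which it starts from `0`, a process with independent
increments has its next increment independent of its previous values. -/
theorem indepFun_increment_range {T : Type*} [Preorder T] {X : T → Ω → ℤ}
    (hX : HasIndepIncrements X P) (hm : ∀ t, Measurable (X t)) {τ : ℕ → T} (hτ : Monotone τ)
    (h0 : ∀ ω, X (τ 0) ω = 0) (n : ℕ) :
    IndepFun (fun ω => X (τ (n + 1)) ω - X (τ n) ω)
      (fun ω (i : Fin (n + 1)) => X (τ i) ω) P := by
  -- Increment `n` is independent of increments `0, …, n - 1`, whose partial sums telescope to the
  -- earlier values.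
  have key := (hX.nat hτ).indepFun_finset {n} (Finset.range n) (by simp)
    fun i => (hm _).sub (hm _)
  have hψ : Measurable fun (y : Finset.range n → ℤ) (i : Fin (n + 1)) =>
      ∑ l : Fin i, y ⟨l, Finset.mem_range.2 (by omega)⟩ := by fun_prop
  have hφ : Measurable fun y : ({n} : Finset ℕ) → ℤ => y ⟨n, by simp⟩ := by fun_prop
  refine (key.comp hφ hψ).congr (.of_forall fun ω => rfl) (.of_forall fun ω => funext fun i => ?_)
  simp only [Function.comp_apply]
  rw [Fin.sum_univ_eq_sum_range (fun l => X (τ (l + 1)) ω - X (τ l) ω) i,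
    Finset.sum_range_sub (fun l => X (τ l) ω), h0, sub_zero]

/-- A finite set of times in `[0, s]` is covered by an initial segment of a monotone sequence that
starts at `0`, and reaches `s` and then `t`. -/
theorem exists_monotone_seq {s t : ℝ≥0} (hst : s ≤ t) (I : Finset (Set.Iic s)) :
    ∃ (τ : ℕ → ℝ≥0) (n : ℕ), Monotone τ ∧ τ 0 = 0 ∧ τ n = s ∧ τ (n + 1) = t ∧
      ∀ u ∈ I, ∃ i : Fin (n + 1), τ i = u := by
  classical
  set J : Finset ℝ≥0 := insert 0 (insert s (I.image Subtype.val)) with hJ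
  have hJs : ∀ u ∈ J, u ≤ s := by
    intro u hu
    simp only [hJ, Finset.mem_insert, Finset.mem_image] at hu
    rcases hu with rfl | rfl | ⟨v, -, rfl⟩
    · exact zero_le
    · exact le_rfl
    · exact v.2
  have hne : J.Nonempty := ⟨0, by simp [hJ]⟩
  obtain ⟨n, hn⟩ : ∃ n, J.card = n + 1 := Nat.exists_eq_succ_of_ne_zero hne.card_pos.ne'
  have hmem : ∀ i, J.orderEmbOfFin hn i ∈ J := fun i => Finset.orderEmbOfFin_mem _ _ _
  -- Enumerate `J` increasingly, then stay at `t`; adjoining `0` and `s` to `J` makes them its first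
  -- and last elements.
  refine ⟨fun i => if h : i < n + 1 then J.orderEmbOfFin hn ⟨i, h⟩ else t, n, ?_, ?_, ?_, ?_, ?_⟩
  · intro a b hab
    dsimp only
    split_ifs with ha hb hb
    · exact (J.orderEmbOfFin hn).monotone hab
    · exact (hJs _ (hmem _)).trans hst
    · omega
    · exact le_rfl
  · simp only [Nat.succ_pos, dif_pos]
    rw [Finset.orderEmbOfFin_zero hn n.succ_pos]
    exact le_antisymm (Finset.min'_le _ _ (by simp [hJ])) zero_le
  · simp only [Nat.lt_succ_self, dif_pos]
    have := Finset.orderEmbOfFin_last hn n.succ_pos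
    simp only [Nat.add_sub_cancel] at this
    rw [this]
    exact le_antisymm (hJs _ (Finset.max'_mem _ _)) (Finset.le_max' _ _ (by simp [hJ]))
  · simp
  · intro u hu
    have : (u : ℝ≥0) ∈ Set.range (J.orderEmbOfFin hn) := by
      rw [Finset.range_orderEmbOfFin]
      exact Finset.mem_insert_of_mem (Finset.mem_insert_of_mem (Finset.mem_image_of_mem _ hu))
    obtain ⟨i, hi⟩ := this
    exact ⟨i, by simpa only [i.is_lt, dif_pos] using hi⟩

/-- An increment of a process with independent increments started at `0` is independent of the
past of the process. -/
theorem indepFun_increment_past [IsProbabilityMeasure P] {X : ℝ≥0 → Ω → ℤ}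
    (hX : HasIndepIncrements X P) (hm : ∀ t, Measurable (X t)) (h0 : ∀ ω, X 0 ω = 0)
    {s t : ℝ≥0} (hst : s ≤ t) :
    IndepFun (fun ω => X t ω - X s ω) (fun ω (u : Set.Iic s) => X u ω) P := by
  -- Independence from a process need only be checked on finitely many times.
  refine IndepFun.indepFun_process ((hm t).sub (hm s)) (fun u => hm u) fun I => ?_
  obtain ⟨τ, n, hτ, hτ0, rfl, rfl, hI⟩ := exists_monotone_seq hst I
  choose i hi using hI
  have key := indepFun_increment_range hX hm hτ (by simpa [hτ0] using h0) n
  have hψ : Measurable fun (y : Fin (n + 1) → ℤ) (u : I) => y (i u u.2) := by fun_prop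
  refine (key.comp measurable_id hψ).congr (.of_forall fun ω => rfl)
    (.of_forall fun ω => funext fun u => ?_)
  simp [hi]

end Independence

/-! ### Law and mean of a counting process -/

section Mean

theorem hasSum_poisson_mean (r : ℝ≥0) :
    HasSum (fun n : ℕ => Real.exp (-r) * (r : ℝ) ^ n / (n.factorial : ℝ) * n) r := by
  -- The term `n = 0` vanishes; after the shift, `(n + 1) / (n + 1)! = 1 / n!` leaves `r` times the
  -- total Poisson mass.
  rw [← hasSum_nat_add_iff' 1]
  simp only [Finset.range_one, Finset.sum_singleton, Nat.cast_zero, mul_zero, sub_zero]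
  have h := (hasSum_one_poissonMeasure r).mul_right (r : ℝ)
  rw [one_mul] at h
  refine (congrArg (HasSum · (r : ℝ)) (funext fun n => ?_)).mp h
  rw [Nat.factorial_succ]
  push_cast
  have : (n.factorial : ℝ) ≠ 0 := by positivity
  have : (n : ℝ) + 1 ≠ 0 := by positivity
  field_simp
  ring

theorem integrable_natCast_poissonMeasure (r : ℝ≥0) :
    Integrable (fun n : ℕ => (n : ℝ)) (poissonMeasure r) := by
  rw [integrable_poissonMeasure_iff]
  simpa using (hasSum_poisson_mean r).summable

theorem integral_natCast_poissonMeasure (r : ℝ≥0) :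
    ∫ n : ℕ, (n : ℝ) ∂(poissonMeasure r) = r := by
  rw [integral_poissonMeasure]
  simpa using (hasSum_poisson_mean r).tsum_eq

theorem mem_jumpCounts {k n : ℕ} {x : Fin k → ℕ} :
    x ∈ jumpCounts k n ↔ ∑ j : Fin k, ((j : ℕ) + 1) * x j = n := by
  simp only [jumpCounts, Finset.mem_filter, Fintype.mem_piFinset, Finset.mem_range,
    and_iff_right_iff_imp]
  rintro rfl j
  have h : ((j : ℕ) + 1) * x j ≤ ∑ j : Fin k, ((j : ℕ) + 1) * x j :=
    Finset.single_le_sum (f := fun j : Fin k => ((j : ℕ) + 1) * x j) (fun _ _ => Nat.zero_le _)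
      (Finset.mem_univ j)
  have : x j ≤ ((j : ℕ) + 1) * x j := Nat.le_mul_of_pos_left _ (Nat.succ_pos _)
  omega

theorem IsIntensity.cumRate_nonneg {k : ℕ} {lam : Fin k → ℝ → ℝ} (h : IsIntensity lam) (j : Fin k)
    (t : ℝ≥0) : 0 ≤ cumRate (lam j) 0 t :=
  intervalIntegral.integral_nonneg t.2 fun u hu => h.nonneg j u hu.1

/-- The joint law of independent Poisson numbers of jumps of sizes `1, …, k` up to time `t`. -/
noncomputable def jumpLaw {k : ℕ} (lam : Fin k → ℝ → ℝ) (t : ℝ≥0) : Measure (Fin k → ℕ) :=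
  Measure.pi fun j => poissonMeasure (cumRate (lam j) 0 t).toNNReal

instance {k : ℕ} (lam : Fin k → ℝ → ℝ) (t : ℝ≥0) : IsProbabilityMeasure (jumpLaw lam t) := by
  unfold jumpLaw
  infer_instance

theorem jumpLaw_real_singleton {k : ℕ} {lam : Fin k → ℝ → ℝ} (h : IsIntensity lam) (t : ℝ≥0)
    (x : Fin k → ℕ) :
    (jumpLaw lam t).real {x} =
      (∏ j, cumRate (lam j) 0 t ^ x j / (Nat.factorial (x j) : ℝ)) *
        Real.exp (-∑ j, cumRate (lam j) 0 t) := by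
  rw [jumpLaw, measureReal_def, Measure.pi_singleton, ENNReal.toReal_prod,
    ← Finset.sum_neg_distrib, Real.exp_sum, ← Finset.prod_mul_distrib]
  refine Finset.prod_congr rfl fun j _ => ?_
  rw [← measureReal_def, poissonMeasure_real_singleton, Real.coe_toNNReal _ (h.cumRate_nonneg j t)]
  ring

variable {Ω : Type*} {m : MeasurableSpace Ω} [MeasurableSpace Ω] {P : Measure Ω} [IsProbabilityMeasure P] {k : ℕ}
  {lam : Fin k → ℝ → ℝ} {M : ℝ≥0 → Ω → ℕ}

/-- The fibre of the weighted sum over `n` is `jumpCounts k n`, and summing the product Poisson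
masses over it gives `incrementProb lam 0 t n`. -/
theorem IsNGCP.map_eq (hM : IsNGCP P lam M) (h : IsIntensity lam) (t : ℝ≥0) :
    P.map (M t) = (jumpLaw lam t).map fun x => ∑ j : Fin k, ((j : ℕ) + 1) * x j := by
  have := Measure.isProbabilityMeasure_map (μ := P) (hM.measurable t).aemeasurable
  have hg : Measurable fun x : Fin k → ℕ => ∑ j : Fin k, ((j : ℕ) + 1) * x j := by fun_prop
  have := Measure.isProbabilityMeasure_map (μ := jumpLaw lam t) hg.aemeasurable
  refine ext_iff_measureReal_singleton.2 fun n => ?_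
  have hpre : (fun x : Fin k → ℕ => ∑ j : Fin k, ((j : ℕ) + 1) * x j) ⁻¹' {n} =
      (jumpCounts k n : Set (Fin k → ℕ)) := by
    ext x
    simp [mem_jumpCounts]
  rw [map_measureReal_apply (hM.measurable t) (measurableSet_singleton n),
    map_measureReal_apply hg (measurableSet_singleton n), hpre, ← sum_measureReal_singleton]
  simp only [jumpLaw_real_singleton h]
  rw [← incrementProb, ← hM.increment_law 0 t zero_le n]
  congr 1
  ext ω
  simp [hM.zero]

theorem integrable_jumpLaw (j : Fin k) (t : ℝ≥0) :
    Integrable (fun x : Fin k → ℕ => ((j : ℕ) + 1 : ℝ) * x j) (jumpLaw lam t) :=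
  (integrable_comp_eval (integrable_natCast_poissonMeasure _)).const_mul _

theorem IsNGCP.integrable (hM : IsNGCP P lam M) (h : IsIntensity lam) (t : ℝ≥0) :
    Integrable (fun ω => (M t ω : ℝ)) P := by
  have hg : Measurable fun x : Fin k → ℕ => ∑ j : Fin k, ((j : ℕ) + 1) * x j := by fun_prop
  suffices Integrable (fun n : ℕ => (n : ℝ)) (P.map (M t)) from
    this.comp_measurable (hM.measurable t)
  rw [hM.map_eq h, integrable_map_measure .of_discrete hg.aemeasurable]
  simpa [Function.comp_def] using integrable_finsetSum Finset.univ
    fun j _ => integrable_jumpLaw (lam := lam) j t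

theorem IsNGCP.integral_eq (hM : IsNGCP P lam M) (h : IsIntensity lam) (t : ℝ≥0) :
    ∫ ω, (M t ω : ℝ) ∂P = ∑ j : Fin k, ((j : ℕ) + 1 : ℝ) * cumRate (lam j) 0 t := by
  have hg : Measurable fun x : Fin k → ℕ => ∑ j : Fin k, ((j : ℕ) + 1) * x j := by fun_prop
  rw [← integral_map (f := fun n : ℕ => (n : ℝ)) (hM.measurable t).aemeasurable .of_discrete,
    hM.map_eq h, integral_map hg.aemeasurable .of_discrete]
  push_cast
  rw [integral_finsetSum _ fun j _ => integrable_jumpLaw j t]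
  refine Finset.sum_congr rfl fun j _ => ?_
  have hj := integral_comp_eval (i := j) (f := fun n : ℕ => (n : ℝ))
    (μ := fun j => poissonMeasure (cumRate (lam j) 0 t).toNNReal) .of_discrete
  rw [integral_natCast_poissonMeasure, Real.coe_toNNReal _ (h.cumRate_nonneg j t)] at hj
  rw [integral_const_mul, jumpLaw, hj]

/-- An increment of a counting process has constant conditional expectation given any
`σ`-algebra contained in that of the past of the process together with an independent process. -/
theorem IsNGCP.condExp_increment (hM : IsNGCP P lam M) (h : IsIntensity lam)
    {N : ℝ≥0 → Ω → ℕ} (hN : ∀ t, Measurable (N t))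
    (hMN : IndepFun (fun ω t => M t ω) (fun ω t => N t ω) P) {s t : ℝ≥0} (hst : s ≤ t)
    (hm : m ≤ MeasurableSpace.comap
      (fun ω => ((fun u : Set.Iic s => (M u ω : ℤ)), (fun u => N u ω))) inferInstance) :
    P[fun ω => (M t ω : ℝ) - M s ω | m] =ᵐ[P] fun _ =>
      ∑ j : Fin k, ((j : ℕ) + 1 : ℝ) * cumRate (lam j) 0 t -
        ∑ j : Fin k, ((j : ℕ) + 1 : ℝ) * cumRate (lam j) 0 s := by
  have hcast : ∀ t, Measurable fun ω => (M t ω : ℤ) :=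
    fun t => measurable_from_top.comp (hM.measurable t)
  have hpast : Measurable fun ω (u : Set.Iic s) => (M u ω : ℤ) :=
    measurable_pi_lambda _ fun u => hcast u
  have hN' : Measurable fun ω u => N u ω := measurable_pi_lambda _ hN
  have hinc : Measurable fun ω => (M t ω : ℤ) - M s ω := (hcast t).sub (hcast s)
  have hpair : Measurable fun y : ℝ≥0 → ℕ =>
      ((y t : ℤ) - y s, fun u : Set.Iic s => (y u : ℤ)) := by
    have hc : ∀ u : ℝ≥0, Measurable fun y : ℝ≥0 → ℕ => (y u : ℤ) :=
      fun u => measurable_from_top.comp (measurable_pi_apply u)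
    exact ((hc t).sub (hc s)).prodMk (measurable_pi_lambda _ fun u => hc u)
  -- The increment and the past are jointly a function of the path of `M`, hence jointly independent
  -- of `N`.
  have hind := indepFun_prodMk_right_of_indepFun_prodMk_left hinc hpast hN'
    (indepFun_increment_past hM.indepIncrements hcast (by simp [hM.zero]) hst)
    (hMN.comp hpair measurable_id)
  have hmle := hm.trans (hpast.prodMk hN').comap_le
  have hmeas : StronglyMeasurable[MeasurableSpace.comap (fun ω => (M t ω : ℤ) - M s ω)
      inferInstance] fun ω => (M t ω : ℝ) - M s ω := by
    refine Measurable.stronglyMeasurable ?_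
    have := (measurable_from_top (f := fun z : ℤ => (z : ℝ))).comp
      (comap_measurable fun ω => (M t ω : ℤ) - M s ω)
    simpa [Function.comp_def] using this
  refine (condExp_indep_eq hinc.comap_le hmle hmeas
    (indep_of_indep_of_le_right ((IndepFun_iff_Indep _ _ _).1 hind) hm)).trans ?_
  rw [integral_sub (hM.integrable h t) (hM.integrable h s), hM.integral_eq h, hM.integral_eq h]

end Mean

/-! ### The martingale property -/

theorem naturalFiltration_le {Ω : Type*} {m : MeasurableSpace Ω} [MeasurableSpace Ω]
    {S : ℝ≥0 → Ω → ℤ} (hS : ∀ t, Measurable (S t)) {s : ℝ≥0}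
    (h : ∀ u ≤ s, Measurable[m] (S u)) : naturalFiltration S hS s ≤ m :=
  iSup₂_le fun u hu => (h u hu.2).comap_le

theorem measurable_naturalFiltration {Ω : Type*} [MeasurableSpace Ω] {S : ℝ≥0 → Ω → ℤ}
    (hS : ∀ t, Measurable (S t)) (h0 : ∀ ω, S 0 ω = 0) (t : ℝ≥0) :
    Measurable[naturalFiltration S hS t] (S t) := by
  -- Time `0` is not among the generators of the filtration, but `S 0` is constant.
  rcases eq_or_ne t 0 with rfl | ht
  · rw [show S 0 = fun _ => 0 from funext h0]
    exact measurable_const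
  · exact Measurable.mono (comap_measurable (S t))
      (le_iSup₂_of_le t ⟨pos_iff_ne_zero.2 ht, le_rfl⟩ le_rfl) le_rfl

end Skellam

theorem mainTheorem6 {Ω : Type*} [MeasurableSpace Ω] (P : Measure Ω) [IsProbabilityMeasure P]
    (k : ℕ) (lam gam : Fin k → ℝ → ℝ)
    (hlam : Skellam.IsIntensity lam) (hgam : Skellam.IsIntensity gam)
    (S : ℝ≥0 → Ω → ℤ) (hS : Skellam.IsNGSP P lam gam S) :
    Martingale
      (fun (t : ℝ≥0) (ω : Ω) => (S t ω : ℝ) -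
        ∑ j : Fin k, ((j : ℕ) + 1 : ℝ) *
          (Skellam.cumRate (lam j) 0 t - Skellam.cumRate (gam j) 0 t))
      (Skellam.naturalFiltration S hS.measurable) P := by
  have hmS := hS.measurable
  obtain ⟨M₁, M₂, h₁, h₂, hind, hS'⟩ := id hS
  have hS0 : ∀ ω, S 0 ω = 0 := fun ω => by simp [hS', h₁.zero, h₂.zero]
  have hadapt : ∀ t, StronglyMeasurable[Skellam.naturalFiltration S hmS t]
      fun ω => (S t ω : ℝ) := fun t =>
    (measurable_from_top.comp
      (Skellam.measurable_naturalFiltration hmS hS0 t)).stronglyMeasurable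
  refine ⟨fun t => (hadapt t).sub stronglyMeasurable_const, fun s t hst => ?_⟩
  have hle := (Skellam.naturalFiltration S hmS).le s
  have e₁ := h₁.condExp_increment hlam h₂.measurable hind hst
    (m := Skellam.naturalFiltration S hmS s) <| Skellam.naturalFiltration_le hmS fun u hu => by
      have hg : Measurable fun y : (Set.Iic s → ℤ) × (ℝ≥0 → ℕ) => y.1 ⟨u, hu⟩ - (y.2 u : ℤ) :=
        Measurable.sub (by fun_prop) (measurable_from_top.comp (by fun_prop))
      rw [show S u = fun ω => (M₁ u ω : ℤ) - M₂ u ω from funext (hS' u)]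
      exact hg.comp (comap_measurable fun ω =>
        ((fun u : Set.Iic s => (M₁ u ω : ℤ)), (fun u => M₂ u ω)))
  have e₂ := h₂.condExp_increment hgam h₁.measurable hind.symm hst
    (m := Skellam.naturalFiltration S hmS s) <| Skellam.naturalFiltration_le hmS fun u hu => by
      have hg : Measurable fun y : (Set.Iic s → ℤ) × (ℝ≥0 → ℕ) => (y.2 u : ℤ) - y.1 ⟨u, hu⟩ :=
        Measurable.sub (measurable_from_top.comp (by fun_prop)) (by fun_prop)
      rw [show S u = fun ω => (M₁ u ω : ℤ) - M₂ u ω from funext (hS' u)]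
      exact hg.comp (comap_measurable fun ω =>
        ((fun u : Set.Iic s => (M₂ u ω : ℤ)), (fun u => M₁ u ω)))
  have i₁ : ∀ t, Integrable (fun ω => (M₁ t ω : ℝ)) P := h₁.integrable hlam
  have i₂ : ∀ t, Integrable (fun ω => (M₂ t ω : ℝ)) P := h₂.integrable hgam
  have iS : Integrable (fun ω => (S s ω : ℝ)) P := by
    simpa [hS', Pi.sub_def] using (i₁ s).sub (i₂ s)
  set c : ℝ := ∑ j : Fin k, ((j : ℕ) + 1 : ℝ) *
    (Skellam.cumRate (lam j) 0 t - Skellam.cumRate (gam j) 0 t) with hc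
  -- Here `c` is the compensator at time `t`; the means of the two increments turn it into the one
  -- at time `s`.
  have hdecomp : (fun ω => (S t ω : ℝ) - c) =
      ((fun ω => (M₁ t ω : ℝ) - M₁ s ω) - fun ω => (M₂ t ω : ℝ) - M₂ s ω) +
        fun ω => (S s ω : ℝ) - c := by
    funext ω
    simp [hS']
    ring
  change P[fun ω => (S t ω : ℝ) - c | _] =ᵐ[P] _
  rw [hdecomp]
  have i₁' : Integrable (fun ω => (M₁ t ω : ℝ) - M₁ s ω) P := (i₁ t).sub (i₁ s)
  have i₂' : Integrable (fun ω => (M₂ t ω : ℝ) - M₂ s ω) P := (i₂ t).sub (i₂ s)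
  have iSc : Integrable (fun ω => (S s ω : ℝ) - c) P := iS.sub (integrable_const c)
  have e₃ : P[fun ω => (S s ω : ℝ) - c | Skellam.naturalFiltration S hmS s] =
      fun ω => (S s ω : ℝ) - c :=
    condExp_of_stronglyMeasurable hle ((hadapt s).sub stronglyMeasurable_const) iSc
  filter_upwards [e₁, e₂, condExp_add (i₁'.sub i₂') iSc (Skellam.naturalFiltration S hmS s),
    condExp_sub i₁' i₂' (Skellam.naturalFiltration S hmS s)] with ω a₁ a₂ a₃ a₄
  simp only [mul_sub, Finset.sum_sub_distrib] at hc ⊢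
  rw [a₃, Pi.add_apply, e₃, a₄, Pi.sub_apply, a₁, a₂, hc]
  ring
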